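/- In the best-choice prophet secretary problem with the origins of the values revealed, one is given probability distributions $D_1,\dots,D_n$ on $\mathbb{R}$ with $n\ge 1$, known in advance. Values $x_i\sim D_i$ are drawn independently and are presented in a uniformly random order $\pi$ that is independent of the values. At step $k$ the algorithm sees $\pi_k$ and $x_{\pi_k}$ (so it learns which distribution produced the value) and must irrevocably choose this value, which ends the process, or pass. The algorithm may depend on $D_1,\dots,D_n$ and may use independent random numbers. It succeeds if it chooses a value and that value equals $\max_i x_i$. A single-threshold algorithm chooses the first value that is at least a fixed threshold $\tau$ (possibly breaking ties with $\tau$ at random: a value equal to $\tau$ is accepted if and only if a fresh uniform random number from $[0,1]$ is at least a fixed $\bar y$). The maximum $$M=\max_{\lambda\ge 0}\sum_{k=1}^{\infty}\frac1k\,\frac{\lambda^k e^{-\lambda}}{k!}$$ exists, and there is an absolute constant $\varepsilon_0>0$ such that for all $n\ge 1$ and all probability distributions $D_1,\dots,D_n$ on $\mathbb{R}$ (with no further assumption; atoms are allowed) there is an algorithm that succeeds with probability at least $M+\varepsilon_0$. Single-threshold algorithms are therefore not optimal in this model: for every $\delta>0$ there are $n\ge1$ and distributions $D_1,\dots,D_n$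 for which every single-threshold algorithm succeeds with probability less than $M+\delta$. -/

import Mathlib

open MeasureTheory

noncomputable section

namespace ProphetSecretary

/-- What is revealed at one step of a best-choice prophet secretary instance with `n` distributions:
the index of the distribution that produced the current value, the value itself, and a fresh
random number (uniform on `[0,1]`) that a rule may use for randomization and for breaking ties. -/
abbrev Obs (n : ℕ) : Type := Fin n × ℝ × ℝ

/-- An online algorithm for `n` values (it is chosen with the distributions known): for every
step `k`, the measurable set of histories of observations, up to and including step `k`, at which
it chooses the current value. Only the first such step counts, as the process stops there. -/
structure OnlineAlg (n : ℕ) where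
  accept : (k : Fin n) → Set (Fin ((k : ℕ) + 1) → Obs n)
  measurableSet_accept : ∀ k, MeasurableSet (accept k)

/-- The observations up to and including step `k`, when the values `x` arrive in the order
`x (π 0), x (π 1), …` and the random numbers of the successive steps are `y 0, y 1, …`. -/
def history {n : ℕ} (π : Equiv.Perm (Fin n)) (x y : Fin n → ℝ) (k : Fin n) :
    Fin ((k : ℕ) + 1) → Obs n :=
  fun j => (π (Fin.castLE k.isLt j), x (π (Fin.castLE k.isLt j)), y (Fin.castLE k.isLt j))

/-- The algorithm `A` stops at step `k`: it accepts at this step and at no earlier one. -/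
def OnlineAlg.StopsAt {n : ℕ} (A : OnlineAlg n) (π : Equiv.Perm (Fin n)) (x y : Fin n → ℝ)
    (k : Fin n) : Prop :=
  history π x y k ∈ A.accept k ∧ ∀ j < k, history π x y j ∉ A.accept j

/-- The algorithm `A` succeeds: it chooses some value, and that value equals the maximum. -/
def OnlineAlg.Succeeds {n : ℕ} (A : OnlineAlg n) (π : Equiv.Perm (Fin n)) (x y : Fin n → ℝ) :
    Prop :=
  ∃ k, A.StopsAt π x y k ∧ ∀ i, x i ≤ x (π k)

/-- The joint law of the values, which are independent with `x i` drawn from `D i`, and of the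
random numbers of the steps, which are independent, uniform on `[0,1]`, and independent of the
values. -/
def law {n : ℕ} (D : Fin n → Measure ℝ) : Measure ((Fin n → ℝ) × (Fin n → ℝ)) :=
  (Measure.pi D).prod (Measure.pi fun _ => volume.restrict (Set.Icc (0 : ℝ) 1))

/-- The probability that `A` chooses the maximum when the values are drawn independently from the
`D i` and are presented in a uniformly random order (independent of the values): the average, over
all permutations `π`, of the success probability for the order `π`. -/
def successProb {n : ℕ} (D : Fin n → Measure ℝ) (A : OnlineAlg n) : ℝ :=
  (∑ π : Equiv.Perm (Fin n), (law D).real {xy | A.Succeeds π xy.1 xy.2}) / (n.factorial : ℝ)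

/-- The single-threshold algorithm with threshold `τ` and secondary, tie-breaking threshold `ybar`:
choose the first value `v` with `v > τ`, or with `v = τ` and random number at least `ybar`.
For `ybar ≤ 0` this is the first value `≥ τ`, for `ybar > 1` (almost surely) the first `> τ`. -/
def singleThreshold (n : ℕ) (τ ybar : ℝ) : OnlineAlg n where
  accept k := {h | τ < (h (Fin.last k)).2.1 ∨
    ((h (Fin.last k)).2.1 = τ ∧ ybar ≤ (h (Fin.last k)).2.2)}
  measurableSet_accept k := by
    have h1 : Measurable fun h : Fin ((k : ℕ) + 1) → Obs n => (h (Fin.last k)).2.1 := by fun_prop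
    have h2 : Measurable fun h : Fin ((k : ℕ) + 1) → Obs n => (h (Fin.last k)).2.2 := by fun_prop
    exact (measurableSet_lt measurable_const h1).union
      ((measurableSet_eq_fun h1 measurable_const).inter (measurableSet_le measurable_const h2))

/-- The series `∑_{k ≥ 1} (1/k) * (lam^k * exp (-lam) / k!)` (the summation index is shifted by
one). -/
def poissonSum (lam : ℝ) : ℝ :=
  ∑' k : ℕ, 1 / ((k : ℝ) + 1) * (lam ^ (k + 1) * Real.exp (-lam) / ((k + 1).factorial : ℝ))

/-- The series that defines `poissonSum` converges. -/
theorem summable_poissonSum (lam : ℝ) :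
    Summable fun k : ℕ =>
      1 / ((k : ℝ) + 1) * (lam ^ (k + 1) * Real.exp (-lam) / ((k + 1).factorial : ℝ)) := by
  have h0 : Summable fun k : ℕ => |lam| ^ (k + 1) / ((k + 1).factorial : ℝ) :=
    (summable_nat_add_iff 1).2 (Real.summable_pow_div_factorial |lam|)
  refine Summable.of_norm_bounded (h0.mul_left (Real.exp (-lam))) fun k => ?_
  have hk : (1 : ℝ) / ((k : ℝ) + 1) ≤ 1 := by
    rw [div_le_one (by positivity)]
    linarith [(Nat.cast_nonneg k : (0 : ℝ) ≤ k)]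
  have hpos : (0 : ℝ) ≤ 1 / ((k : ℝ) + 1) := by positivity
  rw [Real.norm_eq_abs, abs_mul, abs_of_nonneg hpos, abs_div, abs_mul, abs_pow,
    abs_of_pos (Real.exp_pos _), abs_of_nonneg (Nat.cast_nonneg (α := ℝ) _)]
  have hB : (0 : ℝ) ≤ |lam| ^ (k + 1) * Real.exp (-lam) / ((k + 1).factorial : ℝ) := by positivity
  calc _ ≤ 1 * (|lam| ^ (k + 1) * Real.exp (-lam) / ((k + 1).factorial : ℝ)) :=
        mul_le_mul_of_nonneg_right hk hB
    _ = _ := by ring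

end ProphetSecretary

end

open MeasureTheory

namespace ProphetSecretary

/-! Fix a threshold that no value passes with probability `exp (-lam)`, and let `T` be the random
set of indices that pass. If `T` is nonempty it contains a maximizer, which arrives first among `T`
in a fraction `1 / |T|` of the orders. So the success probability is at least the mean of `1 / |T|`,
and `poissonSum_le_meanInvCard` bounds that mean below by `poissonSum lam`, whatever the
distributions; take `lam` maximal.

To gain a constant, lower the threshold to level `exp (-(lam + 1))` for the last `m` steps, about a
fraction `δ` of them. The gain comes from the event that exactly one index passes the low threshold
and it fails the high one: it is collected whenever that index arrives late, so with chance `m / n`,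
and the event has probability at least `exp (-(lam + 1))` (`le_pairLaw_real_onlyHit`). A loss
requires the maximizer and another index passing the low threshold to be both late, which costs at
most `2 * δ * (m / n)` times the mean number of such indices, itself at most `lam + 1`
(`card_switchSucceeds_ge`, `sum_real_le`). The loss is of second order in `δ`, so a small `δ` leaves
a net gain (`exists_onlineAlg_ge`).

Conversely, for i.i.d. uniform values the maximizer is almost surely unique, so a single threshold
succeeds with probability at most the mean of `1 / |T|`, with `|T|` binomial. Poisson approximation
bounds it by `M + δ` for a suitable large `n`, uniformly in the threshold
(`exists_meanInvCard_const_lt`). -/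

/-! ### Existence of the maximum of the Poisson series. -/

theorem poissonSum_le_two_div {lam : ℝ} (h : 0 < lam) : poissonSum lam ≤ 2 / lam := by
  have hs : Summable fun k : ℕ => lam ^ (k + 2) / ((k + 2).factorial : ℝ) :=
    (summable_nat_add_iff 2).2 (Real.summable_pow_div_factorial lam)
  have hle : ∑' k : ℕ, lam ^ (k + 2) / ((k + 2).factorial : ℝ) ≤ Real.exp lam := by
    have h1 := (Real.summable_pow_div_factorial lam).sum_add_tsum_nat_add 2
    have h2 : Real.exp lam = ∑' k : ℕ, lam ^ k / (k.factorial : ℝ) := by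
      rw [Real.exp_eq_exp_ℝ, NormedSpace.exp_eq_tsum_div]
    rw [h2, ← h1]
    have : 0 ≤ ∑ k ∈ Finset.range 2, lam ^ k / (k.factorial : ℝ) :=
      Finset.sum_nonneg fun _ _ => by positivity
    linarith
  calc poissonSum lam
      ≤ ∑' k : ℕ, 2 / lam * Real.exp (-lam) * (lam ^ (k + 2) / ((k + 2).factorial : ℝ)) := by
        refine (summable_poissonSum lam).tsum_le_tsum (fun k => ?_) (hs.mul_left _)
        have hk : (0 : ℝ) < ((k + 1).factorial : ℝ) := by positivity
        have h2 : (((k + 2).factorial : ℕ) : ℝ) = (k + 2) * ((k + 1).factorial : ℝ) := by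
          rw [Nat.factorial_succ (k + 1)]; push_cast; ring
        rw [h2]
        -- Since `1 / (k + 1) ≤ 2 / (k + 2)`, the harmonic factor merges into the factorial and
        -- leaves a shifted exponential series.
        have h3 : 2 / lam * Real.exp (-lam) * (lam ^ (k + 2) / ((k + 2) * ((k + 1).factorial : ℝ)))
            = 2 / ((k : ℝ) + 2) * (lam ^ (k + 1) * Real.exp (-lam) / ((k + 1).factorial : ℝ)) := by
          field_simp
          ring
        rw [h3]
        refine mul_le_mul_of_nonneg_right ?_ (by positivity)
        rw [div_le_div_iff₀ (by positivity) (by positivity)]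
        linarith [(Nat.cast_nonneg k : (0 : ℝ) ≤ k)]
    _ = 2 / lam * Real.exp (-lam) * ∑' k : ℕ, lam ^ (k + 2) / ((k + 2).factorial : ℝ) :=
        tsum_mul_left
    _ ≤ 2 / lam * Real.exp (-lam) * Real.exp lam := by gcongr
    _ = 2 / lam := by rw [mul_assoc, ← Real.exp_add]; simp

theorem poissonSum_pos {lam : ℝ} (h : 0 < lam) : 0 < poissonSum lam :=
  (summable_poissonSum lam).tsum_pos (fun k => by positivity) 0 (by positivity)

theorem continuousOn_poissonSum (R : ℝ) : ContinuousOn poissonSum (Set.Icc 0 R) := by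
  have hs : Summable fun k : ℕ => R ^ (k + 1) / ((k + 1).factorial : ℝ) :=
    (summable_nat_add_iff 1).2 (Real.summable_pow_div_factorial R)
  refine continuousOn_tsum (fun k => by fun_prop) hs fun k x hx => ?_
  obtain ⟨h0, hR⟩ := hx
  have hR0 : 0 ≤ R := h0.trans hR
  rw [Real.norm_of_nonneg (by positivity)]
  have h1 : (1 : ℝ) / ((k : ℝ) + 1) ≤ 1 := by
    rw [div_le_one (by positivity)]
    linarith [(Nat.cast_nonneg k : (0 : ℝ) ≤ k)]
  have h2 : Real.exp (-x) ≤ 1 := Real.exp_le_one_iff.2 (by linarith)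
  calc _ ≤ 1 * (R ^ (k + 1) * 1 / ((k + 1).factorial : ℝ)) := by gcongr
    _ = _ := by ring

theorem exists_poissonSum_maximal :
    ∃ lam : ℝ, 0 < lam ∧ ∀ x, 0 ≤ x → poissonSum x ≤ poissonSum lam := by
  have h1 : 0 < poissonSum 1 := poissonSum_pos one_pos
  -- Beyond this radius the bound `2 / x` is below `poissonSum 1`, so a maximum over the compact
  -- interval is global.
  set R : ℝ := max 1 (2 / poissonSum 1)
  have hR : 1 ≤ R := le_max_left _ _
  obtain ⟨lam, hlam, hmax⟩ := isCompact_Icc.exists_isMaxOn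
    (Set.nonempty_Icc.2 (zero_le_one.trans hR)) (continuousOn_poissonSum R)
  have h1l : poissonSum 1 ≤ poissonSum lam := hmax ⟨zero_le_one, hR⟩
  refine ⟨lam, hlam.1.lt_of_ne ?_, fun x hx => ?_⟩
  · rintro rfl
    have : poissonSum 0 = 0 := by simp [poissonSum]
    linarith
  · rcases le_or_gt x R with h | h
    · exact hmax ⟨hx, h⟩
    · have hx0 : 0 < x := by linarith
      refine ((poissonSum_le_two_div hx0).trans ?_).trans h1l
      rw [div_le_iff₀ hx0]
      have := (le_max_right 1 (2 / poissonSum 1)).trans h.le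
      rw [div_le_iff₀ h1] at this
      linarith

/-! ### Mean inverse size of a random set, compared with the Poisson series. -/

/-- The mean of `1 / |T|` (and `0` for `T = ∅`) for the random set `T` that contains each `i`
independently with probability `p i`. -/
noncomputable def meanInvCard {n : ℕ} (p : Fin n → ℝ) : ℝ :=
  ∑ T : Finset (Fin n), (∏ i, if i ∈ T then p i else 1 - p i) * (1 / (T.card : ℝ))

theorem sum_prod_ite_mul_pow {n : ℕ} (p : Fin n → ℝ) (s : ℝ) :
    ∑ T : Finset (Fin n), (∏ i, if i ∈ T then p i else 1 - p i) * s ^ T.card =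
      ∏ i, (p i * s + (1 - p i)) := by
  rw [Finset.prod_add, Finset.powerset_univ]
  refine Finset.sum_congr rfl fun T _ => ?_
  rw [Finset.prod_ite, Finset.prod_mul_distrib, Finset.prod_const, Finset.filter_mem_eq_inter,
    Finset.univ_inter, Finset.filter_notMem_eq_sdiff]
  ring

/-- Writing `1 / k` as the integral of `s ^ (k - 1)` over `[0,1]` turns both sides into integrals of
generating functions. Bernoulli's inequality `(1 - p) ^ (1 - s) ≤ 1 - p + p * s`, multiplied over
the indices, shows that the generating function of `|T|` dominates the Poisson one, `exp (-lam * (1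
- s))`, while both agree at `s = 0`. -/
theorem poissonSum_le_meanInvCard {n : ℕ} (p : Fin n → ℝ) (h1 : ∀ i, p i ≤ 1)
    {lam : ℝ} (hlam : 0 ≤ lam) (hp : ∏ i, (1 - p i) = Real.exp (-lam)) :
    poissonSum lam ≤ meanInvCard p := by
  refine (summable_poissonSum lam).tsum_le_of_sum_range_le fun N => ?_
  have hL : ∑ k ∈ Finset.range N,
        1 / ((k : ℝ) + 1) * (lam ^ (k + 1) * Real.exp (-lam) / ((k + 1).factorial : ℝ)) =
      ∫ s in (0 : ℝ)..1, ∑ k ∈ Finset.range N,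
        (lam ^ (k + 1) * Real.exp (-lam) / ((k + 1).factorial : ℝ)) * s ^ k := by
    rw [intervalIntegral.integral_finsetSum fun k _ =>
      (Continuous.intervalIntegrable (by fun_prop) _ _)]
    refine Finset.sum_congr rfl fun k _ => ?_
    rw [intervalIntegral.integral_const_mul, integral_pow]
    simp; ring
  have hR : meanInvCard p = ∫ s in (0 : ℝ)..1, ∑ T : Finset (Fin n),
      (∏ i, if i ∈ T then p i else 1 - p i) *
        (if T.card = 0 then 0 else s ^ (T.card - 1)) := by
    rw [intervalIntegral.integral_finsetSum fun T _ =>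
      (Continuous.intervalIntegrable (by split_ifs <;> fun_prop) _ _)]
    refine Finset.sum_congr rfl fun T _ => ?_
    rw [intervalIntegral.integral_const_mul]
    congr 1
    by_cases hT : T.card = 0
    · simp [hT]
    · obtain ⟨k, hk⟩ := Nat.exists_eq_succ_of_ne_zero hT
      simp [hk, integral_pow]
  rw [hL, hR]
  refine intervalIntegral.integral_mono_on_of_le_Ioo zero_le_one
    (Continuous.intervalIntegrable (by fun_prop) _ _)
    (Continuous.intervalIntegrable ?_ _ _) fun s hs => ?_
  · refine continuous_finsetSum _ fun T _ => continuous_const.mul ?_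
    split_ifs <;> fun_prop
  · obtain ⟨hs0, hs1⟩ := hs
    -- Multiplying by `s` restores the full generating functions, minus their values at `0`, which
    -- account for the empty set.
    refine le_of_mul_le_mul_left ?_ hs0
    have e1 : s * ∑ k ∈ Finset.range N,
          (lam ^ (k + 1) * Real.exp (-lam) / ((k + 1).factorial : ℝ)) * s ^ k =
        Real.exp (-lam) * ((∑ k ∈ Finset.range (N + 1), (lam * s) ^ k / (k.factorial : ℝ)) - 1) := by
      rw [Finset.sum_range_succ', Finset.mul_sum]
      simp only [pow_zero, Nat.factorial_zero, Nat.cast_one, div_one, add_sub_cancel_right]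
      rw [Finset.mul_sum]
      refine Finset.sum_congr rfl fun k _ => ?_
      ring
    have e2 : s * ∑ T : Finset (Fin n), (∏ i, if i ∈ T then p i else 1 - p i) *
        (if T.card = 0 then 0 else s ^ (T.card - 1)) =
        ∏ i, (p i * s + (1 - p i)) - ∏ i, (1 - p i) := by
      have h0 : ∏ i, (1 - p i) = ∑ T : Finset (Fin n),
          (∏ i, if i ∈ T then p i else 1 - p i) * (0 : ℝ) ^ T.card := by
        rw [sum_prod_ite_mul_pow]; simp
      rw [← sum_prod_ite_mul_pow, h0, ← Finset.sum_sub_distrib, Finset.mul_sum]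
      refine Finset.sum_congr rfl fun T _ => ?_
      by_cases hT : T.card = 0
      · simp [hT]
      · obtain ⟨k, hk⟩ := Nat.exists_eq_succ_of_ne_zero hT
        simp [hk, pow_succ]; ring
    rw [e1, e2, hp]
    have b1 : ∑ k ∈ Finset.range (N + 1), (lam * s) ^ k / (k.factorial : ℝ) ≤
        Real.exp (lam * s) := Real.sum_le_exp_of_nonneg (by positivity) _
    have b2 : Real.exp (-lam) * Real.exp (lam * s) ≤ ∏ i, (p i * s + (1 - p i)) := by
      calc Real.exp (-lam) * Real.exp (lam * s) = (∏ i, (1 - p i)) ^ (1 - s) := by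
            rw [hp, ← Real.exp_mul, ← Real.exp_add]; ring_nf
        _ = ∏ i, (1 - p i) ^ (1 - s) :=
            (Real.finsetProd_rpow _ _ (fun i _ => by linarith [h1 i]) _).symm
        _ ≤ _ := by
            refine Finset.prod_le_prod
              (fun i _ => Real.rpow_nonneg (by linarith [h1 i]) _) fun i _ => ?_
            have := rpow_one_add_le_one_add_mul_self (s := -p i) (p := 1 - s)
              (by linarith [h1 i]) (by linarith) (by linarith)
            rw [← sub_eq_add_neg] at this
            linarith
    nlinarith [mul_le_mul_of_nonneg_left b1 (Real.exp_pos (-lam)).le]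

theorem meanInvCard_const (n : ℕ) (p : ℝ) :
    meanInvCard (fun _ : Fin n => p) =
      ∑ k ∈ Finset.range (n + 1),
        (n.choose k : ℝ) * (p ^ k * (1 - p) ^ (n - k)) * (1 / (k : ℝ)) := by
  rw [meanInvCard, ← Finset.powerset_univ, Finset.sum_powerset]
  simp only [Finset.card_univ, Fintype.card_fin]
  refine Finset.sum_congr rfl fun k _ => ?_
  rw [Finset.sum_congr rfl (g := fun _ => p ^ k * (1 - p) ^ (n - k) * (1 / (k : ℝ)))]
  · rw [Finset.sum_const, Finset.card_powersetCard]
    simp; ring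
  · intro T hT
    have hk := (Finset.mem_powersetCard.1 hT).2
    rw [Finset.prod_ite, Finset.prod_const, Finset.prod_const, Finset.filter_mem_eq_inter,
      Finset.univ_inter, Finset.filter_notMem_eq_sdiff, Finset.card_univ_sdiff, hk, Fintype.card_fin]

/-- Useful when `n * p` is large. Replace `1 / k` by `2 / (k + 1)` and absorb `k + 1` into the
binomial coefficient: what remains is a part of the binomial expansion of order `n + 1`, with sum at
most `1`. -/
theorem meanInvCard_const_le_two_div (n : ℕ) {p : ℝ} (h0 : 0 < p) (h1 : p ≤ 1) :
    meanInvCard (fun _ : Fin n => p) ≤ 2 / (((n : ℝ) + 1) * p) := by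
  have h1' : 0 ≤ 1 - p := by linarith
  have hb : (1 : ℝ) = ∑ k ∈ Finset.range (n + 2),
      p ^ k * (1 - p) ^ (n + 1 - k) * ((n + 1).choose k : ℝ) := by
    rw [← add_pow]; simp
  rw [Finset.sum_range_succ'] at hb
  have hle : ∑ k ∈ Finset.range (n + 1),
      p ^ (k + 1) * (1 - p) ^ (n + 1 - (k + 1)) * ((n + 1).choose (k + 1) : ℝ) ≤ 1 := by
    have : 0 ≤ p ^ 0 * (1 - p) ^ (n + 1 - 0) * ((n + 1).choose 0 : ℝ) := by positivity
    linarith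
  rw [meanInvCard_const, le_div_iff₀ (by positivity), Finset.sum_mul]
  refine le_trans ?_ (mul_le_mul_of_nonneg_left hle zero_le_two |>.trans_eq (mul_one 2))
  rw [Finset.mul_sum]
  refine Finset.sum_le_sum fun k _ => ?_
  have hc : ((n : ℝ) + 1) * (n.choose k : ℝ) = ((n + 1).choose (k + 1) : ℝ) * ((k : ℝ) + 1) := by
    exact_mod_cast Nat.add_one_mul_choose_eq n k
  have hk : 1 / (k : ℝ) * ((k : ℝ) + 1) ≤ 2 := by
    rcases Nat.eq_zero_or_pos k with rfl | hk
    · simp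
    · have : (1 : ℝ) ≤ k := by exact_mod_cast hk
      rw [one_div, ← div_eq_inv_mul, div_le_iff₀ (by positivity)]
      linarith
  rw [Nat.add_sub_add_right]
  calc (n.choose k : ℝ) * (p ^ k * (1 - p) ^ (n - k)) * (1 / (k : ℝ)) * (((n : ℝ) + 1) * p)
      = (p ^ (k + 1) * (1 - p) ^ (n - k)) * (1 / (k : ℝ)) * (((n : ℝ) + 1) * (n.choose k : ℝ)) := by
        ring
    _ = (p ^ (k + 1) * (1 - p) ^ (n - k) * ((n + 1).choose (k + 1) : ℝ)) *
        (1 / (k : ℝ) * ((k : ℝ) + 1)) := by rw [hc]; ring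
    _ ≤ (p ^ (k + 1) * (1 - p) ^ (n - k) * ((n + 1).choose (k + 1) : ℝ)) * 2 := by gcongr
    _ = _ := by ring

/-- Poisson approximation by termwise domination: `n.choose k ≤ n ^ k / k!`, and the factor `(1 - p)
^ (-k)` is absorbed by taking `n * p / (1 - p)` as parameter instead of `n * p`. The exponential
prefactor pays for that change. -/
theorem meanInvCard_const_le_exp_mul_poissonSum (n : ℕ) {p : ℝ} (h0 : 0 ≤ p) (h1 : p < 1) :
    meanInvCard (fun _ : Fin n => p) ≤
      Real.exp (n * p ^ 2 / (1 - p)) * poissonSum (n * p / (1 - p)) := by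
  have h1' : 0 < 1 - p := by linarith
  set μ : ℝ := n * p / (1 - p) with hμ
  have hμ0 : 0 ≤ μ := by positivity
  have hexp : (1 - p) ^ n ≤ Real.exp (n * p ^ 2 / (1 - p)) * Real.exp (-μ) := by
    have h2 : 1 - p ≤ Real.exp (-p) := by linarith [Real.add_one_le_exp (-p)]
    calc (1 - p) ^ n ≤ Real.exp (-p) ^ n := by gcongr
      _ = _ := by
        rw [← Real.exp_nat_mul, ← Real.exp_add, hμ]
        congr 1
        field_simp
        ring
  rw [meanInvCard_const, Finset.sum_range_succ', poissonSum, ← tsum_mul_left]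
  simp only [Nat.cast_zero, div_zero, mul_zero, add_zero]
  refine le_trans (Finset.sum_le_sum fun k hk => ?_)
    (((summable_poissonSum μ).mul_left _).sum_le_tsum (Finset.range n) fun k _ => by positivity)
  have hkn : k + 1 ≤ n := Finset.mem_range.1 hk
  have hc : (n.choose (k + 1) : ℝ) ≤ (n : ℝ) ^ (k + 1) / ((k + 1).factorial : ℝ) :=
    Nat.choose_le_pow_div _ _
  have hpow : (1 - p) ^ (n - (k + 1)) = (1 - p) ^ n / (1 - p) ^ (k + 1) := by
    rw [eq_div_iff (by positivity), ← pow_add, Nat.sub_add_cancel hkn]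
  push_cast
  calc (n.choose (k + 1) : ℝ) * (p ^ (k + 1) * (1 - p) ^ (n - (k + 1))) * (1 / ((k : ℝ) + 1))
      ≤ (n : ℝ) ^ (k + 1) / ((k + 1).factorial : ℝ) *
          (p ^ (k + 1) * ((Real.exp (n * p ^ 2 / (1 - p)) * Real.exp (-μ)) / (1 - p) ^ (k + 1))) *
          (1 / ((k : ℝ) + 1)) := by
        rw [hpow]; gcongr
    _ = _ := by rw [hμ, div_pow, mul_pow]; ring

/-! ### Counting arrival orders. -/

/-- Every order has exactly one first element of `S`, and swapping two labels in `S` shows that all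
elements are first equally often. -/
theorem card_perm_first {n : ℕ} {S : Finset (Fin n)} {i : Fin n} (hi : i ∈ S) :
    ((Finset.univ.filter fun π : Equiv.Perm (Fin n) =>
      ∀ j ∈ S, π.symm i ≤ π.symm j).card : ℝ) = n.factorial * (1 / (S.card : ℝ)) := by
  have hsum : ∑ a ∈ S, (Finset.univ.filter fun π : Equiv.Perm (Fin n) =>
      ∀ j ∈ S, π.symm a ≤ π.symm j).card = n.factorial := by
    simp only [Finset.card_filter]
    rw [Finset.sum_comm, Finset.sum_congr rfl (g := fun _ => 1)]
    · simp [Fintype.card_perm]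
    · intro π _
      obtain ⟨a, ha, hmin⟩ := S.exists_min_image π.symm ⟨i, hi⟩
      rw [Finset.sum_eq_single_of_mem a ha, if_pos hmin]
      intro b hb hba
      rw [if_neg]
      intro h
      exact hba (π.symm.injective (le_antisymm (h a ha) (hmin b hb)))
  have hconst : ∀ a ∈ S, (Finset.univ.filter fun π : Equiv.Perm (Fin n) =>
      ∀ j ∈ S, π.symm a ≤ π.symm j).card = (Finset.univ.filter fun π : Equiv.Perm (Fin n) =>
      ∀ j ∈ S, π.symm i ≤ π.symm j).card := by
    intro a ha
    refine Finset.card_equiv (Equiv.mulLeft (Equiv.swap a i)) fun π => ?_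
    have hS : ∀ j, j ∈ S ↔ Equiv.swap a i j ∈ S := by
      intro j
      rcases eq_or_ne j a with rfl | hja
      · simp [ha, hi]
      · rcases eq_or_ne j i with rfl | hji
        · simp [ha, hi]
        · rw [Equiv.swap_apply_of_ne_of_ne hja hji]
    have hval : ∀ j, (Equiv.swap a i * π).symm j = π.symm (Equiv.swap a i j) := fun j => by
      rw [Equiv.symm_apply_eq]; simp
    simp only [Finset.mem_filter, Finset.mem_univ, true_and, Equiv.coe_mulLeft, hval,
      Equiv.swap_apply_right]
    constructor
    · intro h j hj
      exact h _ ((hS j).1 hj)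
    · intro h j hj
      simpa using h _ ((hS j).1 hj)
  rw [Finset.sum_congr rfl hconst, Finset.sum_const, smul_eq_mul] at hsum
  have hS : (0 : ℝ) < S.card := by exact_mod_cast Finset.card_pos.2 ⟨i, hi⟩
  rw [← hsum]
  push_cast
  field_simp

theorem card_filter_le_add {n m : ℕ} (h : m ≤ n) (π : Equiv.Perm (Fin n)) :
    (Finset.univ.filter fun j : Fin n => n ≤ (π.symm j : ℕ) + m).card = m := by
  have h1 : (Finset.univ.filter fun j : Fin n => n ≤ (π.symm j : ℕ) + m).card =
      (Finset.univ.filter fun k : Fin n => n ≤ (k : ℕ) + m).card :=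
    Finset.card_equiv π.symm fun j => by simp
  rw [h1, Finset.card_filter, Fin.sum_univ_eq_sum_range (fun k => if n ≤ k + m then 1 else 0),
    ← Finset.card_filter]
  have h2 : (Finset.range n).filter (fun k => n ≤ k + m) = Finset.Ico (n - m) n := by
    ext k; simp; omega
  rw [h2, Nat.card_Ico]
  omega

theorem card_perm_late {n m : ℕ} (h : m ≤ n) (i : Fin n) :
    n * (Finset.univ.filter fun π : Equiv.Perm (Fin n) => n ≤ (π.symm i : ℕ) + m).card =
      n.factorial * m := by
  have hsum : ∑ a : Fin n, (Finset.univ.filter fun π : Equiv.Perm (Fin n) =>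
      n ≤ (π.symm a : ℕ) + m).card = n.factorial * m := by
    simp only [Finset.card_filter]
    rw [Finset.sum_comm]
    simp only [← Finset.card_filter, card_filter_le_add h]
    simp [Fintype.card_perm]
  rw [← hsum, Finset.sum_congr rfl (g := fun _ =>
    (Finset.univ.filter fun π : Equiv.Perm (Fin n) => n ≤ (π.symm i : ℕ) + m).card)]
  · simp
  · intro a _
    refine Finset.card_equiv (Equiv.mulLeft (Equiv.swap a i)) fun π => ?_
    have hval : (Equiv.swap a i * π).symm i = π.symm a := by
      rw [Equiv.symm_apply_eq]; simp
    simp [hval]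

theorem card_perm_late_late {n m : ℕ} (h : m ≤ n) {i j : Fin n} (hij : i ≠ j) :
    (n - 1) * (Finset.univ.filter fun π : Equiv.Perm (Fin n) =>
        n ≤ (π.symm i : ℕ) + m ∧ n ≤ (π.symm j : ℕ) + m).card =
      (m - 1) * (Finset.univ.filter fun π : Equiv.Perm (Fin n) =>
        n ≤ (π.symm i : ℕ) + m).card := by
  have hsum : ∑ a ∈ Finset.univ.erase i, (Finset.univ.filter fun π : Equiv.Perm (Fin n) =>
      n ≤ (π.symm i : ℕ) + m ∧ n ≤ (π.symm a : ℕ) + m).card =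
      (m - 1) * (Finset.univ.filter fun π : Equiv.Perm (Fin n) =>
        n ≤ (π.symm i : ℕ) + m).card := by
    simp only [Finset.card_filter]
    rw [Finset.sum_comm, Finset.mul_sum]
    refine Finset.sum_congr rfl fun π _ => ?_
    by_cases hi : n ≤ (π.symm i : ℕ) + m
    · simp only [hi, true_and, if_true, mul_one]
      rw [← Finset.card_filter, Finset.filter_erase, Finset.card_erase_of_mem (by simpa using hi),
        card_filter_le_add h]
    · simp [hi]
  rw [← hsum, Finset.sum_congr rfl (g := fun _ =>
    (Finset.univ.filter fun π : Equiv.Perm (Fin n) =>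
      n ≤ (π.symm i : ℕ) + m ∧ n ≤ (π.symm j : ℕ) + m).card)]
  · simp
  · intro a ha
    have hai : i ≠ a := (Finset.ne_of_mem_erase ha).symm
    refine Finset.card_equiv (Equiv.mulLeft (Equiv.swap a j)) fun π => ?_
    have hval : ∀ b, (Equiv.swap a j * π).symm b = π.symm (Equiv.swap a j b) := fun b => by
      rw [Equiv.symm_apply_eq]; simp
    simp [hval, Equiv.swap_apply_of_ne_of_ne hai hij]

/-- In the order `π`, the first step `k` at which `π k` is a candidate (an element of `S` on the
first `n - m` steps, of `S'` on the last `m` steps) exists and its `π k` maximizes `x`. -/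
def SwitchSucceeds {n : ℕ} (m : ℕ) (S S' : Finset (Fin n)) (x : Fin n → ℝ)
    (π : Equiv.Perm (Fin n)) : Prop :=
  ∃ k : Fin n, (π k ∈ (if (k : ℕ) + m < n then S else S') ∧
    ∀ j < k, π j ∉ (if (j : ℕ) + m < n then S else S')) ∧ ∀ i, x i ≤ x (π k)

-- If a maximizer `i` comes first among `S`, failure can only be caused by some other `j ∈ S'`
-- accepted before `i` under the wider rule, and then `i` and `j` both lie in the last `m` steps. A
-- union bound over `j` gives the subtracted term.
open scoped Classical in
theorem card_switchSucceeds_ge {n m : ℕ} (hm : m ≤ n) {S S' : Finset (Fin n)} (hSS : S ⊆ S')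
    {x : Fin n → ℝ} (hS : ∀ i ∈ S, ∀ j ∉ S, x j ≤ x i) {c : ℝ} (hc : 0 ≤ c)
    (hmc : (m : ℝ) - 1 ≤ c * (n - 1)) :
    1 / (S.card : ℝ) - c * (m / n) * S'.card ≤
      ((Finset.univ.filter (SwitchSucceeds m S S' x)).card : ℝ) / n.factorial := by
  rcases S.eq_empty_or_nonempty with rfl | hne
  · have h1 : 0 ≤ c * ((m : ℝ) / n) * S'.card := by positivity
    have h2 : 0 ≤ ((Finset.univ.filter (SwitchSucceeds m ∅ S' x)).card : ℝ) / n.factorial := by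
      positivity
    simp only [Finset.card_empty, Nat.cast_zero, div_zero]
    linarith
  obtain ⟨i, hi, hmax⟩ := S.exists_max_image x hne
  have hmax' : ∀ j, x j ≤ x i := fun j => by
    by_cases hj : j ∈ S
    · exact hmax j hj
    · exact hS i hi j hj
  have hn : (0 : ℝ) < n := by exact_mod_cast i.pos
  have hf : (0 : ℝ) < n.factorial := by positivity
  have hpair : ∀ j ∈ S'.erase i, ((Finset.univ.filter fun π : Equiv.Perm (Fin n) =>
      n ≤ (π.symm i : ℕ) + m ∧ n ≤ (π.symm j : ℕ) + m).card : ℝ) ≤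
      n.factorial * (c * (m / n)) := by
    intro j hj
    have hji := (Finset.ne_of_mem_erase hj).symm
    have h1 := card_perm_late_late hm hji
    have h2 : (n : ℝ) * ((Finset.univ.filter fun π : Equiv.Perm (Fin n) =>
      n ≤ (π.symm i : ℕ) + m).card : ℝ) = n.factorial * m := by exact_mod_cast card_perm_late hm i
    have hn1 : 1 < n := by
      have := Fin.val_ne_of_ne hji
      omega
    have hn1' : (0 : ℝ) < (n : ℝ) - 1 := by
      have : (1 : ℝ) < n := by exact_mod_cast hn1
      linarith
    -- The case `m = 0` is separate because `m - 1` is a truncated subtraction in `h1`.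
    rcases Nat.eq_zero_or_pos m with rfl | hm0
    · have : (Finset.univ.filter fun π : Equiv.Perm (Fin n) =>
          n ≤ (π.symm i : ℕ) + 0 ∧ n ≤ (π.symm j : ℕ) + 0) = ∅ := by
        refine Finset.filter_false_of_mem fun π _ h => ?_
        have := (π.symm i).isLt
        omega
      rw [this]; simp
    have h3 : ((n : ℝ) - 1) * ((Finset.univ.filter fun π : Equiv.Perm (Fin n) =>
        n ≤ (π.symm i : ℕ) + m ∧ n ≤ (π.symm j : ℕ) + m).card : ℝ) =
        (m - 1) * ((Finset.univ.filter fun π : Equiv.Perm (Fin n) =>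
        n ≤ (π.symm i : ℕ) + m).card : ℝ) := by
      have := congrArg (Nat.cast (R := ℝ)) h1
      push_cast [Nat.cast_sub hn1.le, Nat.cast_sub (Nat.succ_le_of_lt hm0)] at this
      exact this
    refine le_of_mul_le_mul_left ?_ hn1'
    rw [h3]
    have h4 : ((Finset.univ.filter fun π : Equiv.Perm (Fin n) =>
        n ≤ (π.symm i : ℕ) + m).card : ℝ) = n.factorial * m / n := by
      rw [eq_div_iff hn.ne', ← h2]; ring
    rw [h4]
    calc ((m : ℝ) - 1) * (n.factorial * m / n) ≤ (c * (n - 1)) * (n.factorial * m / n) := by gcongr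
      _ = _ := by ring
  have hsub : (Finset.univ.filter fun π : Equiv.Perm (Fin n) => ∀ j ∈ S, π.symm i ≤ π.symm j) ⊆
      (Finset.univ.filter (SwitchSucceeds m S S' x)) ∪
        (S'.erase i).biUnion fun j => Finset.univ.filter fun π : Equiv.Perm (Fin n) =>
          n ≤ (π.symm i : ℕ) + m ∧ n ≤ (π.symm j : ℕ) + m := by
    intro π hπ
    have hfirst : ∀ j ∈ S, π.symm i ≤ π.symm j := by simpa using hπ
    by_contra hcon
    simp only [Finset.mem_union, Finset.mem_filter, Finset.mem_univ, true_and, Finset.mem_biUnion,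
      not_or, not_exists, not_and] at hcon
    obtain ⟨hA, hB⟩ := hcon
    refine hA ⟨π.symm i, ⟨?_, fun j hj hmem => ?_⟩, by simpa using hmax'⟩
    · rw [Equiv.apply_symm_apply]
      split_ifs
      exacts [hi, hSS hi]
    · have hjS : π j ∉ S := fun h => by
        have := hfirst _ h
        rw [Equiv.symm_apply_apply] at this
        exact absurd hj (not_lt.2 this)
      split_ifs at hmem with hlt
      · exact hjS hmem
      · refine hB (π j) (Finset.mem_erase.2 ⟨?_, hmem⟩) ?_ ?_
        · rintro rfl; exact hjS hi
        · have : (j : ℕ) < (π.symm i : ℕ) := hj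
          omega
        · rw [Equiv.symm_apply_apply]; omega
  have hcard := (Finset.card_le_card hsub).trans (Finset.card_union_le _ _)
  have hcard' := hcard.trans (Nat.add_le_add_left Finset.card_biUnion_le _)
  have hcardR : (n.factorial : ℝ) * (1 / (S.card : ℝ)) ≤
      ((Finset.univ.filter (SwitchSucceeds m S S' x)).card : ℝ) +
      ∑ j ∈ S'.erase i, ((Finset.univ.filter fun π : Equiv.Perm (Fin n) =>
          n ≤ (π.symm i : ℕ) + m ∧ n ≤ (π.symm j : ℕ) + m).card : ℝ) := by
    rw [← card_perm_first hi]; exact_mod_cast hcard'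
  have hbound : ∑ j ∈ S'.erase i, ((Finset.univ.filter fun π : Equiv.Perm (Fin n) =>
          n ≤ (π.symm i : ℕ) + m ∧ n ≤ (π.symm j : ℕ) + m).card : ℝ) ≤
      S'.card * (n.factorial * (c * (m / n))) := by
    refine (Finset.sum_le_card_nsmul _ _ _ hpair).trans ?_
    rw [nsmul_eq_mul]
    refine mul_le_mul_of_nonneg_right ?_ (by positivity)
    exact_mod_cast Finset.card_le_card (Finset.erase_subset _ _)
  rw [le_div_iff₀ hf]
  linarith

open scoped Classical in
theorem card_switchSucceeds_singleton {n m : ℕ} (hm : m ≤ n) {i : Fin n}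
    {x : Fin n → ℝ} (hx : ∀ j, x j ≤ x i) :
    (m : ℝ) / n ≤
      ((Finset.univ.filter (SwitchSucceeds m ∅ {i} x)).card : ℝ) / n.factorial := by
  have hn : (0 : ℝ) < n := by exact_mod_cast i.pos
  have h2 : (n : ℝ) * ((Finset.univ.filter fun π : Equiv.Perm (Fin n) =>
      n ≤ (π.symm i : ℕ) + m).card : ℝ) = n.factorial * m := by exact_mod_cast card_perm_late hm i
  have hsub : (Finset.univ.filter fun π : Equiv.Perm (Fin n) => n ≤ (π.symm i : ℕ) + m) ⊆
      Finset.univ.filter (SwitchSucceeds m ∅ {i} x) := by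
    intro π hπ
    have hπ' : n ≤ (π.symm i : ℕ) + m := by simpa using hπ
    simp only [Finset.mem_filter, Finset.mem_univ, true_and]
    refine ⟨π.symm i, ⟨?_, fun j hj hmem => ?_⟩, by simpa using hx⟩
    · rw [if_neg (by omega)]; simp
    · split_ifs at hmem
      · simp at hmem
      · rw [Finset.mem_singleton] at hmem
        rw [← hmem, Equiv.symm_apply_apply] at hj
        exact lt_irrefl _ hj
  have hle : ((Finset.univ.filter fun π : Equiv.Perm (Fin n) => n ≤ (π.symm i : ℕ) + m).card : ℝ) ≤
      ((Finset.univ.filter (SwitchSucceeds m ∅ {i} x)).card : ℝ) := by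
    exact_mod_cast Finset.card_le_card hsub
  rw [div_le_div_iff₀ hn (by positivity)]
  nlinarith

-- By injectivity every successful order picks the same index. It lies in `S` and must precede the
-- rest of `S`.
open scoped Classical in
theorem card_switchSucceeds_zero_le {n : ℕ} (S S' : Finset (Fin n)) {x : Fin n → ℝ}
    (hx : Function.Injective x) :
    ((Finset.univ.filter (SwitchSucceeds 0 S S' x)).card : ℝ) / n.factorial ≤
      1 / (S.card : ℝ) := by
  have hf : (0 : ℝ) < n.factorial := by positivity
  rcases (Finset.univ.filter (SwitchSucceeds 0 S S' x)).eq_empty_or_nonempty with h0 | ⟨π₀, h0⟩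
  · rw [h0]; simp
  simp only [Finset.mem_filter, Finset.mem_univ, true_and] at h0
  obtain ⟨k₀, ⟨hk₀, -⟩, hmax⟩ := h0
  rw [if_pos (by simp)] at hk₀
  rw [div_le_iff₀ hf, mul_comm, ← card_perm_first hk₀]
  refine Nat.cast_le.2 (Finset.card_le_card fun π hπ => ?_)
  simp only [Finset.mem_filter, Finset.mem_univ, true_and] at hπ ⊢
  obtain ⟨k, ⟨-, hk'⟩, hmaxk⟩ := hπ
  have hkk : π k = π₀ k₀ := hx (le_antisymm (hmax _) (hmaxk _))
  intro j hj
  rw [← hkk, Equiv.symm_apply_apply]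
  by_contra hlt
  have := hk' _ (not_le.1 hlt)
  rw [if_pos (by simp), Equiv.apply_symm_apply] at this
  exact this hj

/-! ### Threshold sets with random tie-breaking, and their attainable levels. -/

/-- The pairs of a value and a random number that pass the threshold `τ` with secondary threshold
`ybar`. -/
def aboveSet (τ ybar : ℝ) : Set (ℝ × ℝ) := {v | τ < v.1 ∨ (v.1 = τ ∧ ybar ≤ v.2)}

theorem measurableSet_aboveSet (τ ybar : ℝ) : MeasurableSet (aboveSet τ ybar) :=
  (measurableSet_lt measurable_const measurable_fst).union
    ((measurableSet_eq_fun measurable_fst measurable_const).inter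
      (measurableSet_le measurable_const measurable_snd))

theorem le_of_mem_aboveSet {τ ybar : ℝ} {v w : ℝ × ℝ} (hv : v ∈ aboveSet τ ybar)
    (hw : w ∉ aboveSet τ ybar) : w.1 ≤ v.1 := by
  simp only [aboveSet, Set.mem_ofPred_eq, not_or, not_lt] at hv hw
  rcases hv with h | h
  · exact hw.1.trans h.le
  · exact hw.1.trans h.1.ge

theorem aboveSet_total (τ ybar τ' ybar' : ℝ) :
    aboveSet τ ybar ⊆ aboveSet τ' ybar' ∨ aboveSet τ' ybar' ⊆ aboveSet τ ybar := by
  rcases lt_trichotomy τ τ' with h | rfl | h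
  · right
    rintro v (hv | hv)
    · exact Or.inl (h.trans hv)
    · exact Or.inl (h.trans_eq hv.1.symm)
  · rcases le_total ybar ybar' with h | h
    · right
      rintro v (hv | hv)
      · exact Or.inl hv
      · exact Or.inr ⟨hv.1, h.trans hv.2⟩
    · left
      rintro v (hv | hv)
      · exact Or.inl hv
      · exact Or.inr ⟨hv.1, h.trans hv.2⟩
  · left
    rintro v (hv | hv)
    · exact Or.inl (h.trans hv)
    · exact Or.inl (h.trans_eq hv.1.symm)

/-- The uniform distribution on `[0,1]`. -/
noncomputable abbrev unif : Measure ℝ := volume.restrict (Set.Icc (0 : ℝ) 1)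

instance : IsProbabilityMeasure unif := ⟨by simp [unif]⟩

theorem real_compl_aboveSet (μ : Measure ℝ) [IsProbabilityMeasure μ] (τ : ℝ) {ybar : ℝ}
    (h0 : 0 ≤ ybar) (h1 : ybar ≤ 1) :
    (μ.prod unif).real (aboveSet τ ybar)ᶜ = μ.real (Set.Iio τ) + ybar * μ.real {τ} := by
  have hset : (aboveSet τ ybar)ᶜ = Set.Iio τ ×ˢ Set.univ ∪ {τ} ×ˢ Set.Iio ybar := by
    ext v
    simp only [aboveSet, Set.mem_compl_iff, Set.mem_ofPred_eq, Set.mem_union, Set.mem_prod,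
      Set.mem_Iio, Set.mem_univ, and_true, Set.mem_singleton_iff, not_or, not_lt, not_and, not_le]
    constructor
    · rintro ⟨h, h'⟩
      rcases h.lt_or_eq with h | h
      · exact Or.inl h
      · exact Or.inr ⟨h, h' h⟩
    · rintro (h | h)
      · exact ⟨h.le, fun h' => absurd h' h.ne⟩
      · exact ⟨h.1.le, fun _ => h.2⟩
  have hu : unif.real (Set.Iio ybar) = ybar := by
    have : Set.Iio ybar ∩ Set.Icc 0 1 = Set.Ico 0 ybar := by
      ext y
      simp only [Set.mem_inter_iff, Set.mem_Iio, Set.mem_Icc, Set.mem_Ico]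
      constructor
      · rintro ⟨a, b, c⟩; exact ⟨b, a⟩
      · rintro ⟨a, b⟩; exact ⟨b, a, by linarith⟩
    rw [measureReal_restrict_apply measurableSet_Iio, this, Real.volume_real_Ico_of_le h0, sub_zero]
  rw [hset, measureReal_union _ ((measurableSet_singleton τ).prod measurableSet_Iio),
    measureReal_prod_prod, measureReal_prod_prod, hu]
  · simp [mul_comm]
  · rw [Set.disjoint_left]
    rintro v ⟨h, -⟩ ⟨h', -⟩
    exact (ne_of_lt h) h'

-- The product of the distribution functions may jump over `c`. At the infimum `τ` of the points
-- where it is at least `c`, its left limit is at most `c` and its value is at least `c`;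
-- tie-breaking at `τ` interpolates continuously between the two, so the intermediate value theorem
-- supplies `ybar`.
open Filter Topology ProbabilityTheory in
theorem exists_aboveSet_prod_eq {n : ℕ} (hn : 1 ≤ n) (D : Fin n → Measure ℝ)
    [∀ i, IsProbabilityMeasure (D i)] {c : ℝ} (h0 : 0 < c) (h1 : c < 1) :
    ∃ τ ybar : ℝ, ∏ i, ((D i).prod unif).real (aboveSet τ ybar)ᶜ = c := by
  set H : ℝ → ℝ := fun t => ∏ i, cdf (D i) t with hH
  have hbot : Tendsto H atBot (𝓝 0) := by
    have := tendsto_finsetProd (Finset.univ : Finset (Fin n)) fun i _ => tendsto_cdf_atBot (D i)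
    rwa [Finset.prod_const, zero_pow (by simp; omega)] at this
  have htop : Tendsto H atTop (𝓝 1) := by
    have := tendsto_finsetProd (Finset.univ : Finset (Fin n)) fun i _ => tendsto_cdf_atTop (D i)
    rwa [Finset.prod_const, one_pow] at this
  have hmono : Monotone H := fun s t hst =>
    Finset.prod_le_prod (fun i _ => cdf_nonneg _ _) fun i _ => monotone_cdf (D i) hst
  set E : Set ℝ := {t | c ≤ H t}
  obtain ⟨t₁, ht₁⟩ := (htop.eventually (lt_mem_nhds h1)).exists
  obtain ⟨t₀, ht₀⟩ := (hbot.eventually (gt_mem_nhds h0)).exists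
  have hE : E.Nonempty := ⟨t₁, le_of_lt ht₁⟩
  have hbdd : BddBelow E := ⟨t₀, fun t ht => by
    by_contra hlt
    exact absurd (hmono (not_le.1 hlt).le) (not_le.2 (ht₀.trans_le ht))⟩
  set τ := sInf E
  have hright : c ≤ H τ := by
    have hcont : Tendsto H (𝓝[>] τ) (𝓝 (H τ)) :=
      tendsto_finsetProd _ fun i _ =>
        ((cdf (D i)).right_continuous τ).tendsto.mono_left (nhdsWithin_mono _ Set.Ioi_subset_Ici_self)
    refine ge_of_tendsto hcont ?_
    filter_upwards [self_mem_nhdsWithin] with t ht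
    obtain ⟨s, hs, hst⟩ := exists_lt_of_csInf_lt hE ht
    exact le_trans hs (hmono hst.le)
  have hIio : ∀ i, (D i).real (Set.Iio τ) = Function.leftLim (cdf (D i)) τ := fun i => by
    have h := (cdf (D i)).measure_Iio (tendsto_cdf_atBot (D i)) τ
    rw [measure_cdf, sub_zero] at h
    rw [measureReal_def, h, ENNReal.toReal_ofReal]
    exact (cdf_nonneg (D i) (τ - 1)).trans ((monotone_cdf (D i)).le_leftLim (by linarith))
  have hleft : ∏ i, (D i).real (Set.Iio τ) ≤ c := by
    simp only [hIio]
    have hcont : Tendsto H (𝓝[<] τ) (𝓝 (∏ i, Function.leftLim (cdf (D i)) τ)) :=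
      tendsto_finsetProd _ fun i _ => (monotone_cdf (D i)).tendsto_leftLim τ
    refine le_of_tendsto hcont ?_
    filter_upwards [self_mem_nhdsWithin] with t ht
    by_contra hlt
    exact absurd (csInf_le hbdd (show t ∈ E from (not_le.1 hlt).le)) (not_le.2 ht)
  have hIic : ∀ i, (D i).real (Set.Iio τ) + (D i).real {τ} = cdf (D i) τ := fun i => by
    rw [cdf_eq_real, ← measureReal_union (by simp) (measurableSet_singleton τ), Set.Iio_union_right]
  have hc : c ∈ (fun y : ℝ => ∏ i, ((D i).real (Set.Iio τ) + y * (D i).real {τ})) '' Set.Icc 0 1 := by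
    refine intermediate_value_Icc zero_le_one (by fun_prop) ⟨?_, ?_⟩
    · simpa using hleft
    · simpa [hIic] using hright
  obtain ⟨y, hy, hyc⟩ := hc
  refine ⟨τ, y, ?_⟩
  rw [← hyc]
  exact Finset.prod_congr rfl fun i _ => real_compl_aboveSet (D i) τ hy.1 hy.2

/-! ### From probabilities to counting orders pointwise. -/

/-- The law of the pairs of value and random number, indexed by the origin of the value. -/
noncomputable def pairLaw {n : ℕ} (D : Fin n → Measure ℝ) : Measure (Fin n → ℝ × ℝ) :=
  Measure.pi fun i => (D i).prod unif

instance {n : ℕ} (D : Fin n → Measure ℝ) [∀ i, IsProbabilityMeasure (D i)] :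
    IsProbabilityMeasure (pairLaw D) := by unfold pairLaw; infer_instance

/-- The random numbers of the steps are i.i.d., so for each fixed order they may be attached to the
values instead. The set of indices passing a threshold then no longer depends on the order. -/
theorem measurePreserving_pairLaw {n : ℕ} (D : Fin n → Measure ℝ)
    [∀ i, IsProbabilityMeasure (D i)] (π : Equiv.Perm (Fin n)) :
    MeasurePreserving (fun w : Fin n → ℝ × ℝ => (fun i => (w i).1, fun k => (w (π k)).2))
      (pairLaw D) (law D) := by
  have h1 := measurePreserving_arrowProdEquivProdArrow ℝ ℝ (Fin n) D fun _ => unif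
  have h2 := measurePreserving_piCongrLeft (fun _ : Fin n => unif) π.symm
  have h3 := ((MeasurePreserving.id (Measure.pi D)).prod h2).comp h1
  unfold pairLaw law
  convert h3 using 1
  funext w
  refine Prod.ext rfl (funext fun k => ?_)
  have := MeasurableEquiv.piCongrLeft_apply_apply π.symm (β := fun _ => ℝ) (fun i => (w i).2) (π k)
  rw [Equiv.symm_apply_apply] at this
  exact this.symm

theorem measurable_history {n : ℕ} (π : Equiv.Perm (Fin n)) (k : Fin n) :
    Measurable fun xy : (Fin n → ℝ) × (Fin n → ℝ) => history π xy.1 xy.2 k := by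
  unfold history
  fun_prop

theorem measurableSet_succeeds {n : ℕ} (A : OnlineAlg n) (π : Equiv.Perm (Fin n)) :
    MeasurableSet {xy : (Fin n → ℝ) × (Fin n → ℝ) | A.Succeeds π xy.1 xy.2} := by
  have hacc : ∀ k, MeasurableSet
      {xy : (Fin n → ℝ) × (Fin n → ℝ) | history π xy.1 xy.2 k ∈ A.accept k} := fun k =>
    measurable_history π k (A.measurableSet_accept k)
  have : {xy : (Fin n → ℝ) × (Fin n → ℝ) | A.Succeeds π xy.1 xy.2} =
      ⋃ k, (({xy | history π xy.1 xy.2 k ∈ A.accept k} ∩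
        ⋂ j, ⋂ _ : j < k, {xy | history π xy.1 xy.2 j ∈ A.accept j}ᶜ) ∩
        ⋂ i, {xy | xy.1 i ≤ xy.1 (π k)}) := by
    ext xy
    simp [OnlineAlg.Succeeds, OnlineAlg.StopsAt]
  rw [this]
  refine MeasurableSet.iUnion fun k => ((hacc k).inter ?_).inter ?_
  · exact MeasurableSet.iInter fun j => MeasurableSet.iInter fun _ => (hacc j).compl
  · exact MeasurableSet.iInter fun i => measurableSet_le (by fun_prop) (by fun_prop)

open scoped Classical in
/-- The fraction of the orders in which `A` succeeds, when each pair of value and random number is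
kept together. -/
noncomputable def successFraction {n : ℕ} (A : OnlineAlg n) (w : Fin n → ℝ × ℝ) : ℝ :=
  ((Finset.univ.filter fun π : Equiv.Perm (Fin n) =>
    A.Succeeds π (fun i => (w i).1) fun k => (w (π k)).2).card : ℝ) / n.factorial

theorem integral_successFraction {n : ℕ} (D : Fin n → Measure ℝ)
    [∀ i, IsProbabilityMeasure (D i)] (A : OnlineAlg n) :
    Integrable (successFraction A) (pairLaw D) ∧
      ∫ w, successFraction A w ∂(pairLaw D) = successProb D A := by
  classical
  set E : Equiv.Perm (Fin n) → Set (Fin n → ℝ × ℝ) := fun π =>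
    {w | A.Succeeds π (fun i => (w i).1) fun k => (w (π k)).2} with hE
  have hEm : ∀ π, MeasurableSet (E π) := fun π =>
    (measurePreserving_pairLaw D π).measurable (measurableSet_succeeds A π)
  have hEi : ∀ π, Integrable ((E π).indicator fun _ => (1 : ℝ)) (pairLaw D) := fun π =>
    (integrable_const 1).indicator (hEm π)
  have heq : successFraction A = fun w =>
      (∑ π, (E π).indicator (fun _ => (1 : ℝ)) w) / n.factorial := by
    funext w
    rw [successFraction, Finset.card_filter]
    push_cast
    congr 1
  rw [heq]
  refine ⟨(integrable_finsetSum _ fun π _ => hEi π).div_const _, ?_⟩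
  rw [integral_div, integral_finsetSum _ fun π _ => hEi π, successProb]
  congr 1
  refine Finset.sum_congr rfl fun π _ => ?_
  rw [integral_indicator_const _ (hEm π), smul_eq_mul, mul_one]
  exact (measurePreserving_pairLaw D π).measureReal_preimage
    (measurableSet_succeeds A π).nullMeasurableSet

/-- The algorithm that accepts according to `B` on the first `n - m` steps and according to `B'` on
the last `m` steps. -/
def switchAlg (n m : ℕ) {B B' : Set (ℝ × ℝ)} (hB : MeasurableSet B) (hB' : MeasurableSet B') :
    OnlineAlg n where
  accept k := {h | (h (Fin.last k)).2 ∈ if (k : ℕ) + m < n then B else B'}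
  measurableSet_accept k := by
    have h1 : Measurable fun h : Fin ((k : ℕ) + 1) → Obs n => (h (Fin.last k)).2 := by fun_prop
    refine h1 ?_
    split_ifs
    exacts [hB, hB']

theorem singleThreshold_eq_switchAlg (n : ℕ) (τ ybar : ℝ) :
    singleThreshold n τ ybar =
      switchAlg n 0 (measurableSet_aboveSet τ ybar) (measurableSet_aboveSet τ ybar) := by
  unfold singleThreshold switchAlg
  congr 1
  funext k
  simp [aboveSet]

open scoped Classical in
/-- The indices whose pairs belong to `B`. -/
noncomputable def hits {n : ℕ} (B : Set (ℝ × ℝ)) (w : Fin n → ℝ × ℝ) : Finset (Fin n) :=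
  Finset.univ.filter fun i => w i ∈ B

@[simp] theorem mem_hits {n : ℕ} {B : Set (ℝ × ℝ)} {w : Fin n → ℝ × ℝ} {i : Fin n} :
    i ∈ hits B w ↔ w i ∈ B := by simp [hits]

theorem switchAlg_succeeds_iff {n m : ℕ} {B B' : Set (ℝ × ℝ)} (hB : MeasurableSet B)
    (hB' : MeasurableSet B') (w : Fin n → ℝ × ℝ) (π : Equiv.Perm (Fin n)) :
    (switchAlg n m hB hB').Succeeds π (fun i => (w i).1) (fun k => (w (π k)).2) ↔
      SwitchSucceeds m (hits B w) (hits B' w) (fun i => (w i).1) π := by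
  have key : ∀ k : Fin n, history π (fun i => (w i).1) (fun k => (w (π k)).2) k ∈
      (switchAlg n m hB hB').accept k ↔
      π k ∈ (if (k : ℕ) + m < n then hits B w else hits B' w) := by
    intro k
    change w (π k) ∈ (if (k : ℕ) + m < n then B else B') ↔ _
    split_ifs <;> simp
  simp only [OnlineAlg.Succeeds, OnlineAlg.StopsAt, key, SwitchSucceeds]

open scoped Classical in
theorem successFraction_switchAlg {n m : ℕ} {B B' : Set (ℝ × ℝ)} (hB : MeasurableSet B)
    (hB' : MeasurableSet B') (w : Fin n → ℝ × ℝ) :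
    successFraction (switchAlg n m hB hB') w =
      ((Finset.univ.filter (SwitchSucceeds m (hits B w) (hits B' w) fun i => (w i).1)).card : ℝ) /
        n.factorial := by
  unfold successFraction
  simp only [switchAlg_succeeds_iff]

theorem pairLaw_real_forall {n : ℕ} (D : Fin n → Measure ℝ) [∀ i, IsProbabilityMeasure (D i)]
    (C : Fin n → Set (ℝ × ℝ)) :
    (pairLaw D).real {w | ∀ i, w i ∈ C i} = ∏ i, ((D i).prod unif).real (C i) := by
  have : {w : Fin n → ℝ × ℝ | ∀ i, w i ∈ C i} = Set.univ.pi C := by ext w; simp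
  rw [this, measureReal_def, pairLaw, Measure.pi_pi, ENNReal.toReal_prod]
  rfl

theorem measurableSet_forall_mem {n : ℕ} {C : Fin n → Set (ℝ × ℝ)}
    (hC : ∀ i, MeasurableSet (C i)) : MeasurableSet {w : Fin n → ℝ × ℝ | ∀ i, w i ∈ C i} := by
  have : {w : Fin n → ℝ × ℝ | ∀ i, w i ∈ C i} = Set.univ.pi C := by ext w; simp
  rw [this]
  exact MeasurableSet.univ_pi hC

/-- The space is split according to the exact set of hits; each piece is a product set, whose
measure is the weight in `meanInvCard`. -/
theorem integral_one_div_card_hits {n : ℕ} (D : Fin n → Measure ℝ)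
    [∀ i, IsProbabilityMeasure (D i)] {B : Set (ℝ × ℝ)} (hB : MeasurableSet B) :
    Integrable (fun w => 1 / ((hits B w).card : ℝ)) (pairLaw D) ∧
      ∫ w, 1 / ((hits B w).card : ℝ) ∂(pairLaw D) =
        meanInvCard fun i => ((D i).prod unif).real B := by
  classical
  set E : Finset (Fin n) → Set (Fin n → ℝ × ℝ) := fun T =>
    {w | ∀ i, w i ∈ if i ∈ T then B else Bᶜ} with hE
  have hEm : ∀ T, MeasurableSet (E T) := fun T => measurableSet_forall_mem fun i => by
    split_ifs
    exacts [hB, hB.compl]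
  have hEi : ∀ T : Finset (Fin n),
      Integrable ((E T).indicator fun _ => 1 / (T.card : ℝ)) (pairLaw D) := fun T =>
    (integrable_const _).indicator (hEm T)
  have hmem : ∀ T w, w ∈ E T ↔ T = hits B w := by
    intro T w
    constructor
    · intro h
      ext i
      have := h i
      split_ifs at this with hi
      · simpa [hi] using this
      · simpa [hi] using this
    · rintro rfl i
      by_cases h : w i ∈ B <;> simp [h]
  have heq : (fun w => 1 / ((hits B w).card : ℝ)) = fun w =>
      ∑ T, (E T).indicator (fun _ => 1 / (T.card : ℝ)) w := by
    funext w
    simp only [Set.indicator_apply, hmem, Finset.sum_ite_eq', Finset.mem_univ, if_true]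
  rw [heq]
  refine ⟨integrable_finsetSum _ fun T _ => hEi T, ?_⟩
  rw [integral_finsetSum _ fun T _ => hEi T, meanInvCard]
  refine Finset.sum_congr rfl fun T _ => ?_
  rw [integral_indicator_const _ (hEm T), smul_eq_mul, pairLaw_real_forall]
  congr 1
  refine Finset.prod_congr rfl fun i _ => ?_
  split_ifs
  · rfl
  · exact probReal_compl_eq_one_sub hB

theorem integral_card_hits {n : ℕ} (D : Fin n → Measure ℝ)
    [∀ i, IsProbabilityMeasure (D i)] {B : Set (ℝ × ℝ)} (hB : MeasurableSet B) :
    Integrable (fun w => ((hits B w).card : ℝ)) (pairLaw D) ∧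
      ∫ w, ((hits B w).card : ℝ) ∂(pairLaw D) = ∑ i, ((D i).prod unif).real B := by
  classical
  set E : Fin n → Set (Fin n → ℝ × ℝ) := fun i => (fun w => w i) ⁻¹' B
  have hEm : ∀ i, MeasurableSet (E i) := fun i => measurable_pi_apply i hB
  have hEi : ∀ i, Integrable ((E i).indicator fun _ => (1 : ℝ)) (pairLaw D) := fun i =>
    (integrable_const _).indicator (hEm i)
  have heq : (fun w => ((hits B w).card : ℝ)) = fun w =>
      ∑ i, (E i).indicator (fun _ => (1 : ℝ)) w := by
    funext w
    rw [hits, Finset.card_filter]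
    push_cast
    rfl
  rw [heq]
  refine ⟨integrable_finsetSum _ fun T _ => hEi T, ?_⟩
  rw [integral_finsetSum _ fun T _ => hEi T]
  refine Finset.sum_congr rfl fun i _ => ?_
  rw [integral_indicator_const _ (hEm i), smul_eq_mul, mul_one]
  exact (measurePreserving_eval (fun i => (D i).prod unif) i).measureReal_preimage
    hB.nullMeasurableSet

/-! ### Gain and loss from lowering the threshold at the end. -/

/-- The event that only the pair `j` belongs to `B'`, and that it does not belong to `B`. -/
def onlyHit {n : ℕ} (B B' : Set (ℝ × ℝ)) (j : Fin n) : Set (Fin n → ℝ × ℝ) :=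
  {w | ∀ i, w i ∈ if i = j then B' \ B else B'ᶜ}

theorem measurableSet_onlyHit {n : ℕ} {B B' : Set (ℝ × ℝ)} (hB : MeasurableSet B)
    (hB' : MeasurableSet B') (j : Fin n) : MeasurableSet (onlyHit B B' j) :=
  measurableSet_forall_mem fun i => by
    split_ifs
    exacts [hB'.diff hB, hB'.compl]

theorem hits_of_mem_onlyHit {n : ℕ} {B B' : Set (ℝ × ℝ)} (hBB : B ⊆ B') {j : Fin n}
    {w : Fin n → ℝ × ℝ} (h : w ∈ onlyHit B B' j) : hits B w = ∅ ∧ hits B' w = {j} := by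
  have hj : w j ∈ B' \ B := by simpa using h j
  have ho : ∀ i, i ≠ j → w i ∉ B' := fun i hi => by simpa [hi] using h i
  constructor
  · ext i
    rcases eq_or_ne i j with rfl | hi
    · simpa using hj.2
    · simpa using fun h => ho i hi (hBB h)
  · ext i
    rcases eq_or_ne i j with rfl | hi
    · simpa using hj.1
    · simpa [hi] using ho i hi

/-- With `a j` and `b j` the probabilities of missing `B` and `B'`, the event for `j` has
probability `(a j / b j - 1) * exp (-mu)`. By `log t ≤ t - 1` this is at least `log (a j / b j) *
exp (-mu)`, and the logarithms add up to `mu - lam`. -/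
theorem le_pairLaw_real_onlyHit {n : ℕ} (D : Fin n → Measure ℝ)
    [∀ i, IsProbabilityMeasure (D i)] {B B' : Set (ℝ × ℝ)} (hB : MeasurableSet B)
    (hB' : MeasurableSet B') (hBB : B ⊆ B') {lam mu : ℝ}
    (hlam : ∏ i, ((D i).prod unif).real Bᶜ = Real.exp (-lam))
    (hmu : ∏ i, ((D i).prod unif).real B'ᶜ = Real.exp (-mu)) :
    (mu - lam) * Real.exp (-mu) ≤ ∑ j, (pairLaw D).real (onlyHit B B' j) := by
  set a : Fin n → ℝ := fun i => ((D i).prod unif).real Bᶜ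
  set b : Fin n → ℝ := fun i => ((D i).prod unif).real B'ᶜ
  have ha : ∀ i, 0 < a i := fun i => lt_of_le_of_ne measureReal_nonneg fun h => by
    rw [Finset.prod_eq_zero (Finset.mem_univ i) h.symm] at hlam
    exact (Real.exp_pos _).ne hlam
  have hb : ∀ i, 0 < b i := fun i => lt_of_le_of_ne measureReal_nonneg fun h => by
    rw [Finset.prod_eq_zero (Finset.mem_univ i) h.symm] at hmu
    exact (Real.exp_pos _).ne hmu
  have hdiff : ∀ i, ((D i).prod unif).real (B' \ B) = a i - b i := fun i => by
    simp only [a, b]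
    rw [measureReal_sdiff hBB hB, probReal_compl_eq_one_sub hB, probReal_compl_eq_one_sub hB']
    ring
  have hj : ∀ j, (Real.log (a j) - Real.log (b j)) * Real.exp (-mu) ≤
      (pairLaw D).real (onlyHit B B' j) := by
    intro j
    have hprod : (pairLaw D).real (onlyHit B B' j) = (a j / b j - 1) * Real.exp (-mu) := by
      rw [onlyHit, pairLaw_real_forall, ← Finset.mul_prod_erase _ _ (Finset.mem_univ j), if_pos rfl,
        hdiff, ← hmu, ← Finset.mul_prod_erase _ _ (Finset.mem_univ j), Finset.prod_congr rfl
          (g := b) fun i hi => by rw [if_neg (Finset.ne_of_mem_erase hi)]]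
      have := (hb j).ne'
      change _ = (a j / b j - 1) * (b j * _)
      field_simp
      rfl
    rw [hprod, ← Real.log_div (ha j).ne' (hb j).ne']
    exact mul_le_mul_of_nonneg_right
      (Real.log_le_sub_one_of_pos (div_pos (ha j) (hb j))) (Real.exp_pos _).le
  refine le_trans (le_of_eq ?_) (Finset.sum_le_sum fun j _ => hj j)
  rw [← Finset.sum_mul, Finset.sum_sub_distrib, ← Real.log_prod fun i _ => (ha i).ne',
    ← Real.log_prod fun i _ => (hb i).ne', hlam, hmu, Real.log_exp, Real.log_exp]
  ring

theorem sum_real_le {n : ℕ} (D : Fin n → Measure ℝ)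
    [∀ i, IsProbabilityMeasure (D i)] {B : Set (ℝ × ℝ)} (hB : MeasurableSet B) {mu : ℝ}
    (hmu : ∏ i, ((D i).prod unif).real Bᶜ = Real.exp (-mu)) :
    ∑ i, ((D i).prod unif).real B ≤ mu := by
  have hb : ∀ i, 0 < ((D i).prod unif).real Bᶜ := fun i =>
    lt_of_le_of_ne measureReal_nonneg fun h => by
      rw [Finset.prod_eq_zero (Finset.mem_univ i) h.symm] at hmu
      exact (Real.exp_pos _).ne hmu
  have h1 : mu = ∑ i, -Real.log (((D i).prod unif).real Bᶜ) := by
    rw [Finset.sum_neg_distrib, ← Real.log_prod fun i _ => (hb i).ne', hmu, Real.log_exp, neg_neg]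
  rw [h1]
  refine Finset.sum_le_sum fun i _ => ?_
  have h2 := Real.log_le_sub_one_of_pos (hb i)
  rw [probReal_compl_eq_one_sub hB] at h2 ⊢
  linarith

/-- A switching algorithm, whose threshold is lowered for the last steps, improves on the bound of
the single-threshold algorithm of parameter `lam`. -/
theorem exists_onlineAlg_ge {lam : ℝ} (hlam : 0 < lam) {n : ℕ} (hn : 1 ≤ n)
    (D : Fin n → Measure ℝ) [∀ i, IsProbabilityMeasure (D i)] {δ : ℝ} (h0 : 0 < δ) (h1 : δ ≤ 1)
    (hδ : 4 * (lam + 1) * δ ≤ Real.exp (-(lam + 1))) :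
    ∃ A : OnlineAlg n,
      poissonSum lam + δ * (Real.exp (-(lam + 1)) / 2) ≤ successProb D A := by
  have hlt : Real.exp (-(lam + 1)) < Real.exp (-lam) := Real.exp_lt_exp.2 (by linarith)
  obtain ⟨τ, y, hB⟩ := exists_aboveSet_prod_eq hn D (Real.exp_pos (-lam))
    (Real.exp_lt_one_iff.2 (by linarith))
  obtain ⟨τ', y', hB'⟩ := exists_aboveSet_prod_eq hn D (Real.exp_pos (-(lam + 1)))
    (Real.exp_lt_one_iff.2 (by linarith))
  have hm := measurableSet_aboveSet τ y
  have hm' := measurableSet_aboveSet τ' y'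
  have hBB : aboveSet τ y ⊆ aboveSet τ' y' := by
    refine (aboveSet_total τ y τ' y').resolve_right fun h => absurd hlt (not_lt.2 ?_)
    rw [← hB, ← hB']
    exact Finset.prod_le_prod (fun _ _ => measureReal_nonneg) fun i _ =>
      measureReal_mono (Set.compl_subset_compl.2 h)
  have hn0 : (0 : ℝ) < n := by exact_mod_cast hn
  set m : ℕ := ⌈δ * n⌉₊ with hmdef
  have hmn : m ≤ n := Nat.ceil_le.2 (by nlinarith)
  have hδm : δ ≤ (m : ℝ) / n := by
    rw [le_div_iff₀ hn0]
    exact Nat.le_ceil _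
  have hmlt : (m : ℝ) < δ * n + 1 := Nat.ceil_lt_add_one (by positivity)
  -- The factor `2` covers `n ≤ 2 * (n - 1)` for `n ≥ 2`; for `n = 1` the right side vanishes, but
  -- `m ≤ 1`.
  have hmc : (m : ℝ) - 1 ≤ 2 * δ * (n - 1) := by
    rcases hn.eq_or_lt with rfl | h2
    · have : (m : ℝ) ≤ (1 : ℕ) := by exact_mod_cast hmn
      push_cast at this ⊢
      linarith
    · have : (2 : ℝ) ≤ n := by exact_mod_cast h2
      nlinarith
  refine ⟨switchAlg n m hm hm', ?_⟩
  obtain ⟨hi0, he0⟩ := integral_successFraction D (switchAlg n m hm hm')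
  obtain ⟨hi1, he1⟩ := integral_one_div_card_hits D hm
  obtain ⟨hi2, he2⟩ := integral_card_hits D hm'
  have hGi : ∀ j, Integrable ((onlyHit (aboveSet τ y) (aboveSet τ' y') j).indicator
      fun _ => (1 : ℝ)) (pairLaw D) := fun j =>
    (integrable_const _).indicator (measurableSet_onlyHit hm hm' j)
  have hi3 := integrable_finsetSum Finset.univ fun j _ => hGi j
  have he3 : ∫ w, ∑ j, (onlyHit (aboveSet τ y) (aboveSet τ' y') j).indicator
      (fun _ => (1 : ℝ)) w ∂(pairLaw D) =
      ∑ j, (pairLaw D).real (onlyHit (aboveSet τ y) (aboveSet τ' y') j) := by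
    rw [integral_finsetSum _ fun j _ => hGi j]
    refine Finset.sum_congr rfl fun j _ => ?_
    rw [integral_indicator_const _ (measurableSet_onlyHit hm hm' j), smul_eq_mul, mul_one]
  -- Pointwise balance of baseline, loss and gain. On an `onlyHit` event the baseline is `1 / 0 =
  -- 0`, so the gain `m / n` is entirely new; off these disjoint events the gain term vanishes.
  have hpt : ∀ w, 1 / ((hits (aboveSet τ y) w).card : ℝ)
      - 2 * δ * (m / n) * (hits (aboveSet τ' y') w).card
      + m / n * ∑ j, (onlyHit (aboveSet τ y) (aboveSet τ' y') j).indicator (fun _ => (1 : ℝ)) w ≤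
      successFraction (switchAlg n m hm hm') w := by
    intro w
    rw [successFraction_switchAlg]
    by_cases hex : ∃ j, w ∈ onlyHit (aboveSet τ y) (aboveSet τ' y') j
    · obtain ⟨j, hj⟩ := hex
      obtain ⟨e1, e2⟩ := hits_of_mem_onlyHit hBB hj
      rw [Finset.sum_eq_single_of_mem j (Finset.mem_univ j), Set.indicator_of_mem hj, e1, e2]
      · refine le_trans ?_ (card_switchSucceeds_singleton hmn fun i => ?_)
        · have : 0 ≤ 2 * δ * ((m : ℝ) / n) := by positivity
          simp only [Finset.card_empty, Nat.cast_zero, div_zero, Finset.card_singleton,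
            Nat.cast_one]
          linarith
        · have hjm : w j ∈ aboveSet τ' y' := mem_hits.1 (e2 ▸ Finset.mem_singleton_self j)
          by_cases hij : i = j
          · rw [hij]
          · refine le_of_mem_aboveSet hjm fun h => hij ?_
            have := mem_hits.2 h
            rwa [e2, Finset.mem_singleton] at this
      · intro i _ hij
        refine Set.indicator_of_notMem (fun hi => hij ?_) _
        have := (hits_of_mem_onlyHit hBB hi).2
        rw [e2, Finset.singleton_inj] at this
        exact this.symm
    · push Not at hex
      rw [Finset.sum_eq_zero fun j _ => Set.indicator_of_notMem (hex j) _, mul_zero, add_zero]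
      refine card_switchSucceeds_ge hmn (fun i => ?_) (fun i hi j hj => ?_) (by positivity) hmc
      · simpa using fun h => hBB h
      · exact le_of_mem_aboveSet (mem_hits.1 hi) fun h => hj (mem_hits.2 h)
  have hi12 : Integrable (fun w => 1 / ((hits (aboveSet τ y) w).card : ℝ)
      - 2 * δ * (m / n) * (hits (aboveSet τ' y') w).card) (pairLaw D) :=
    hi1.sub (hi2.const_mul (2 * δ * ((m : ℝ) / n)))
  have hint := integral_mono (hi12.add (hi3.const_mul ((m : ℝ) / n))) hi0 hpt
  simp only [Pi.add_apply] at hint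
  rw [integral_add hi12 (hi3.const_mul _),
    integral_sub hi1 (hi2.const_mul _), integral_const_mul, integral_const_mul, he0, he1, he2,
    he3] at hint
  have b1 := poissonSum_le_meanInvCard (fun i => ((D i).prod unif).real (aboveSet τ y))
    (fun i => measureReal_le_one) hlam.le (by
      rw [← hB]
      exact Finset.prod_congr rfl fun i _ => (probReal_compl_eq_one_sub hm).symm)
  have b2 := sum_real_le D hm' hB'
  have b3 := le_pairLaw_real_onlyHit D hm hm' hBB hB hB'
  rw [add_sub_cancel_left, one_mul] at b3
  have hmn0 : 0 ≤ (m : ℝ) / n := by positivity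
  have b2' := mul_le_mul_of_nonneg_left b2 (show 0 ≤ 2 * δ * ((m : ℝ) / n) by positivity)
  have b3' := mul_le_mul_of_nonneg_left b3 hmn0
  -- By `hδ` the loss consumes at most half of the gain.
  have b4 : δ * (Real.exp (-(lam + 1)) / 2) ≤
      (m : ℝ) / n * (Real.exp (-(lam + 1)) - 2 * δ * (lam + 1)) := by
    refine mul_le_mul hδm (by linarith) (by positivity) hmn0
  linarith

/-! ### Single thresholds on i.i.d. uniform values. -/

/-- A tie between two coordinates lies in a proper linear subspace, which is Lebesgue-null. -/
theorem ae_injective_pairLaw_unif (n : ℕ) :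
    ∀ᵐ w ∂(pairLaw fun _ : Fin n => unif), Function.Injective fun i => (w i).1 := by
  have hne : ∀ i j : Fin n, i ≠ j →
      ∀ᵐ x ∂(Measure.pi fun _ : Fin n => unif), x i ≠ x j := by
    intro i j hij
    rw [← Measure.restrict_pi_pi]
    refine ae_restrict_of_ae ?_
    let f : (Fin n → ℝ) →ₗ[ℝ] ℝ := LinearMap.proj (R := ℝ) (φ := fun _ => ℝ) i -
      LinearMap.proj (R := ℝ) (φ := fun _ => ℝ) j
    have hf : f.ker ≠ ⊤ := fun h => by
      have h1 := LinearMap.ker_eq_top.1 h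
      have h2 := LinearMap.congr_fun h1 (Pi.single i 1)
      simp [f, hij.symm] at h2
    have h3 := Measure.addHaar_submodule (Measure.pi fun _ : Fin n => (volume : Measure ℝ)) f.ker hf
    refine measure_mono_null (fun x hx => ?_) h3
    have hx' : x i = x j := by simpa using hx
    simp [f, hx']
  have hall : ∀ᵐ x ∂(Measure.pi fun _ : Fin n => unif), Function.Injective x := by
    have h : ∀ᵐ x ∂(Measure.pi fun _ : Fin n => unif), ∀ i j : Fin n, i ≠ j → x i ≠ x j := by
      rw [ae_all_iff]; intro i
      rw [ae_all_iff]; intro j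
      by_cases hij : i = j
      · simp [hij]
      · filter_upwards [hne i j hij] with x hx _ using hx
    filter_upwards [h] with x hx i j hxy
    by_contra hij
    exact hx i j hij hxy
  have hq := (measurePreserving_pairLaw (fun _ : Fin n => unif) 1).quasiMeasurePreserving
  have hfst : Measure.QuasiMeasurePreserving (Prod.fst : (Fin n → ℝ) × (Fin n → ℝ) → _)
      (law fun _ => unif) (Measure.pi fun _ => unif) := Measure.quasiMeasurePreserving_fst
  exact (hfst.comp hq).ae hall

theorem successProb_singleThreshold_unif_le (n : ℕ) (τ ybar : ℝ) :
    successProb (fun _ : Fin n => unif) (singleThreshold n τ ybar) ≤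
      meanInvCard fun _ : Fin n => (unif.prod unif).real (aboveSet τ ybar) := by
  have hm := measurableSet_aboveSet τ ybar
  rw [singleThreshold_eq_switchAlg]
  obtain ⟨hi0, he0⟩ := integral_successFraction (fun _ : Fin n => unif) (switchAlg n 0 hm hm)
  obtain ⟨hi1, he1⟩ := integral_one_div_card_hits (fun _ : Fin n => unif) hm
  rw [← he0, ← he1]
  refine integral_mono_ae hi0 hi1 ?_
  filter_upwards [ae_injective_pairLaw_unif n] with w hw
  rw [successFraction_switchAlg]
  exact card_switchSucceeds_zero_le _ _ hw

-- Uniformity in `p` comes from a cut at `q = 2 / (M * (n + 1))`. For `p ≥ q` the tail bound is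
-- already at most `M`; for `p < q` the mean `n * p` is bounded by `2 / M`, so the prefactor of the
-- Poisson approximation tends to `1` uniformly.
open Filter Topology in
theorem exists_meanInvCard_const_lt {M : ℝ} (hM0 : 0 < M) (hM : ∀ x, 0 ≤ x → poissonSum x ≤ M)
    {δ : ℝ} (hδ : 0 < δ) :
    ∃ n : ℕ, 1 ≤ n ∧ ∀ p : ℝ, 0 ≤ p → p ≤ 1 → meanInvCard (fun _ : Fin n => p) < M + δ := by
  have hq : Tendsto (fun n : ℕ => 2 / M * (1 / ((n : ℝ) + 1))) atTop (𝓝 0) := by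
    simpa using tendsto_one_div_add_atTop_nhds_zero_nat.const_mul (2 / M)
  have hcont : ContinuousAt (fun q : ℝ => Real.exp (2 / M * (q / (1 - q))) * M) 0 := by
    have : ContinuousAt (fun q : ℝ => q / (1 - q)) 0 :=
      continuousAt_id.div (by fun_prop) (by simp)
    fun_prop
  have hlim := hcont.tendsto.comp hq
  simp only [zero_div, mul_zero, Real.exp_zero, one_mul] at hlim
  obtain ⟨n, hn, hq1, hn1⟩ := ((hlim.eventually (gt_mem_nhds (lt_add_of_pos_right M hδ))).and
    ((hq.eventually (gt_mem_nhds one_pos)).and (eventually_ge_atTop 1))).exists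
  refine ⟨n, hn1, fun p h0 h1 => ?_⟩
  set q : ℝ := 2 / M * (1 / ((n : ℝ) + 1)) with hqdef
  have hn' : (0 : ℝ) < (n : ℝ) + 1 := by positivity
  have hqM : ((n : ℝ) + 1) * q = 2 / M := by rw [hqdef]; field_simp
  rcases lt_or_ge p q with hp | hp
  · have hp1 : p < 1 := hp.trans hq1
    have hnp : (n : ℝ) * p ≤ 2 / M := by
      rw [← hqM]
      exact mul_le_mul (by linarith) hp.le h0 hn'.le
    refine lt_of_le_of_lt ?_ hn
    refine (meanInvCard_const_le_exp_mul_poissonSum n h0 hp1).trans ?_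
    have h1p : 0 < 1 - p := by linarith
    have h1q : 0 < 1 - q := by linarith
    refine mul_le_mul (Real.exp_le_exp.2 ?_) (hM _ (by positivity)) ?_ (Real.exp_pos _).le
    · calc (n : ℝ) * p ^ 2 / (1 - p) = (n * p) * (p / (1 - p)) := by ring
        _ ≤ 2 / M * (q / (1 - q)) := by gcongr
    · exact tsum_nonneg fun k => by positivity
  · have hqpos : 0 < q := by positivity
    have hp0 : 0 < p := hqpos.trans_le hp
    refine lt_of_le_of_lt (meanInvCard_const_le_two_div n hp0 h1) ?_
    refine lt_of_le_of_lt ?_ (lt_add_of_pos_right M hδ)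
    rw [div_le_iff₀ (by positivity)]
    have : 2 / M ≤ ((n : ℝ) + 1) * p := by rw [← hqM]; gcongr
    rw [div_le_iff₀ hM0] at this
    linarith

end ProphetSecretary

theorem mainTheorem8 :
    ∃ M : ℝ, IsGreatest (ProphetSecretary.poissonSum '' Set.Ici 0) M ∧
      ∃ ε₀ : ℝ, 0 < ε₀ ∧
        (∀ (n : ℕ) (D : Fin n → Measure ℝ), 1 ≤ n → (∀ i, IsProbabilityMeasure (D i)) →
          ∃ A : ProphetSecretary.OnlineAlg n, M + ε₀ ≤ ProphetSecretary.successProb D A) ∧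
        (∀ δ : ℝ, 0 < δ →
          ∃ (n : ℕ) (D : Fin n → Measure ℝ), 1 ≤ n ∧ (∀ i, IsProbabilityMeasure (D i)) ∧
            ∀ τ ybar : ℝ,
              ProphetSecretary.successProb D (ProphetSecretary.singleThreshold n τ ybar)
                < M + δ) := by
  obtain ⟨lam, hlam, hmax⟩ := ProphetSecretary.exists_poissonSum_maximal
  have he : Real.exp (-(lam + 1)) < 1 := Real.exp_lt_one_iff.2 (by linarith)
  have hδ : 0 < Real.exp (-(lam + 1)) / (4 * (lam + 1)) := by positivity
  have hδ1 : Real.exp (-(lam + 1)) / (4 * (lam + 1)) ≤ 1 := by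
    rw [div_le_one (by positivity)]
    linarith
  -- Here `δ` is the largest value permitted by the balance of gain and loss; it depends only on the
  -- maximizer `lam`, so the improvement is an absolute constant.
  refine ⟨ProphetSecretary.poissonSum lam, ⟨⟨lam, hlam.le, rfl⟩, ?_⟩,
    Real.exp (-(lam + 1)) / (4 * (lam + 1)) * (Real.exp (-(lam + 1)) / 2), by positivity, ?_, ?_⟩
  · rintro _ ⟨x, hx, rfl⟩
    exact hmax x hx
  · intro n D hn hD
    exact ProphetSecretary.exists_onlineAlg_ge hlam hn D hδ hδ1
      (mul_div_cancel₀ _ (by positivity)).le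
  · intro ε hε
    obtain ⟨n, hn, h⟩ := ProphetSecretary.exists_meanInvCard_const_lt
      (ProphetSecretary.poissonSum_pos hlam) hmax hε
    exact ⟨n, fun _ => ProphetSecretary.unif, hn, fun _ => inferInstance, fun τ ybar =>
      (ProphetSecretary.successProb_singleThreshold_unif_le n τ ybar).trans_lt
        (h _ measureReal_nonneg measureReal_le_one)⟩
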